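/- For $y,y'\in\mathbb{R}^p$ write $y\leqq y'$ if $y_j\le y'_j$ for every $j$, and let $\mathbb{R}^p_{\geqq}=\{y\in\mathbb{R}^p : 0\leqq y\}$. For $Y\subseteq\mathbb{R}^p$ let $$Y_N=\{y^0\in Y : \text{there is no } y\in Y \text{ with } y\leqq y^0,\ y\neq y^0\}$$ be the set of nondominated points of $Y$. The set $Y$ is called $\mathbb{R}^p_{\geqq}$-compact if $(y-\mathbb{R}^p_{\geqq})\cap Y$ is compact for every $y\in Y$, and $\mathbb{R}^p_{\geqq}$-semicompact if every cover of $Y$ by (open) sets of the form $(y^i-\mathbb{R}^p_{\geqq})^c$ with $y^i\in Y$, $i\in\mathcal{I}$, has a finite subcover. The set $Y_N$ is called externally stable if $Y\subseteq Y_N+\mathbb{R}^p_{\geqq}$. Let $Y\subseteq\mathbb{R}^p$ be closed and convex. If $Y_N\neq\emptyset$, then all of the following hold: (i) $Y$ is $\mathbb{R}^p_{\geqq}$-compact; (ii) $Y$ is $\mathbb{R}^p_{\geqq}$-semicompact; (iii) $Y_N$ is externally stable; (iv) $Y_N$ is connected. Consequently, for every closed convex $Y\subseteq\mathbb{R}^p$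 the set $Y_N$ is connected (the empty set being counted as connected); that is, Naccache's theorem that $Y_N$ is connected whenever $Y$ is closed, convex and $\mathbb{R}^p_{\geqq}$-compact holds without the hypothesis of $\mathbb{R}^p_{\geqq}$-compactness. -/

import Mathlib

open scoped Pointwise

/-- The natural ordering cone of `ℝ^p`: the vectors with nonnegative components. The order on
`Fin p → ℝ` is the componentwise one, and its topology is the usual topology of `ℝ^p`. -/
def orderingCone (p : ℕ) : Set (Fin p → ℝ) :=
  {y | 0 ≤ y}

/-- The set `Y_N` of nondominated points of `Y`. -/
def nondominated {p : ℕ} (Y : Set (Fin p → ℝ)) : Set (Fin p → ℝ) :=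
  {y₀ | y₀ ∈ Y ∧ ¬ ∃ y ∈ Y, y ≤ y₀ ∧ y ≠ y₀}

/-- Compactness with respect to the ordering cone: all sections `(y - ℝ^p_≧) ∩ Y` with `y ∈ Y`
are compact. -/
def IsConeCompact {p : ℕ} (Y : Set (Fin p → ℝ)) : Prop :=
  ∀ y ∈ Y, IsCompact (({y} - orderingCone p) ∩ Y)

/-- Semicompactness with respect to the ordering cone: every cover of `Y` by complements
`(z - ℝ^p_≧)ᶜ`, with `z` ranging over some subset `S` of `Y`, has a finite subcover. (These
complements are automatically open.) -/
def IsConeSemicompact {p : ℕ} (Y : Set (Fin p → ℝ)) : Prop :=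
  ∀ S ⊆ Y, (Y ⊆ ⋃ z ∈ S, ({z} - orderingCone p)ᶜ) →
    ∃ T ⊆ S, T.Finite ∧ Y ⊆ ⋃ z ∈ T, ({z} - orderingCone p)ᶜ

/-- `Y_N` is externally stable. -/
def NondominatedExternallyStable {p : ℕ} (Y : Set (Fin p → ℝ)) : Prop :=
  Y ⊆ nondominated Y + orderingCone p

/-!
The sections of `Y` below a point `b` are the sets `Y ∩ Set.Iic b`. If one of them is unbounded,
then normalising an unbounded sequence in it yields a recession direction `d ≤ 0`, `d ≠ 0` of `Y`,
and `x + d` dominates every `x ∈ Y`. Hence one nondominated point makes all sections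
compact (`isCompact_inter_Iic`). Semicompactness follows by covering a single section, and
external stability by minimising a strictly monotone function on a section.

For connectedness, any two nondominated points lie below a common `b`, and the nondominated points
of `Y` below `b` are those of the compact convex set `Y ∩ Set.Iic b`; so `Y` may be
assumed compact. For `k > 0` and a reference point `q`, the function
`y ↦ ∑ j, exp (k * (y j - q j))` (`expSum`) is strictly convex and strictly increasing. Its unique
minimiser on `Y` is nondominated and depends continuously on `(k, q)`, so these minimisers form a
connected subset of the nondominated set. This subset is dense in it: if `q` is itself nondominated,
then the minimiser `y` satisfies `exp (k * (y j - q j)) ≤ p`, so that every cluster point as `k → ∞`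
lies below `q` and therefore equals `q`.
-/

open Filter Topology

/-! ### Sections below a point -/

theorem singleton_sub_orderingCone {p : ℕ} (y : Fin p → ℝ) :
    {y} - orderingCone p = Set.Iic y := by
  ext z
  simp only [Set.singleton_sub, Set.mem_image, orderingCone, Set.mem_ofPred_eq, Set.mem_Iic]
  constructor
  · rintro ⟨c, hc, rfl⟩
    exact sub_le_self y hc
  · exact fun h => ⟨y - z, sub_nonneg.2 h, sub_sub_cancel y z⟩

theorem eq_of_mem_nondominated {p : ℕ} {Y : Set (Fin p → ℝ)} {x y : Fin p → ℝ}
    (hx : x ∈ nondominated Y) (hy : y ∈ Y) (h : y ≤ x) : y = x := by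
  by_contra hne
  exact hx.2 ⟨y, hy, h, hne⟩

theorem nondominated_inter_Iic {p : ℕ} (Y : Set (Fin p → ℝ)) (b : Fin p → ℝ) :
    nondominated (Y ∩ Set.Iic b) = nondominated Y ∩ Set.Iic b := by
  ext x
  constructor
  · rintro ⟨⟨hxY, hxb⟩, hx⟩
    exact ⟨⟨hxY, fun ⟨y, hy, hyx, hne⟩ => hx ⟨y, ⟨hy, hyx.trans hxb⟩, hyx, hne⟩⟩, hxb⟩
  · rintro ⟨⟨hxY, hx⟩, hxb⟩
    exact ⟨⟨hxY, hxb⟩, fun ⟨y, hy, hyx, hne⟩ => hx ⟨y, hy.1, hyx, hne⟩⟩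

/-- A limit `d` of the normalised vectors of an unbounded sequence in the section would be a nonzero
recession direction of `Y` with `d ≤ 0`, so that `x + d ∈ Y` would dominate `x`. -/
theorem isCompact_inter_Iic {p : ℕ} {Y : Set (Fin p → ℝ)} (hclosed : IsClosed Y)
    (hconv : Convex ℝ Y) {x : Fin p → ℝ} (hx : x ∈ nondominated Y) (b : Fin p → ℝ) :
    IsCompact (Y ∩ Set.Iic b) := by
  refine Metric.isCompact_of_isClosed_isBounded (hclosed.inter isClosed_Iic) ?_
  by_contra hunb
  have hex : ∀ n : ℕ, ∃ z ∈ Y ∩ Set.Iic b, (n : ℝ) + 1 < ‖z‖ := by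
    intro n
    by_contra! h
    exact hunb (isBounded_iff_forall_norm_le.2 ⟨_, h⟩)
  choose z hz hzn using hex
  have hpos : ∀ n, 0 < ‖z n‖ := fun n => lt_trans (by positivity) (hzn n)
  have hnorm : Tendsto (fun n => ‖z n‖) atTop atTop :=
    tendsto_atTop_mono (fun n => by linarith [hzn n]) tendsto_natCast_atTop_atTop
  have hinv : Tendsto (fun n => ‖z n‖⁻¹) atTop (𝓝 0) := tendsto_inv_atTop_zero.comp hnorm
  obtain ⟨d, hd, φ, hφ, hlim⟩ := (isCompact_sphere (0 : Fin p → ℝ) 1).tendsto_subseq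
    (x := fun n => ‖z n‖⁻¹ • z n) (fun n => by
      simp [norm_smul, (hpos n).ne'])
  have hinvφ := hinv.comp hφ.tendsto_atTop
  have hd0 : d ≤ 0 := by
    have hb : Tendsto (fun n => ‖z (φ n)‖⁻¹ • b) atTop (𝓝 0) := by
      simpa using hinvφ.smul_const b
    exact le_of_tendsto_of_tendsto' hlim hb fun n =>
      smul_le_smul_of_nonneg_left (hz (φ n)).2 (inv_nonneg.2 (norm_nonneg _))
  have hxd : x + d ∈ Y := by
    have hl : Tendsto (fun n => (1 - ‖z (φ n)‖⁻¹) • x + ‖z (φ n)‖⁻¹ • z (φ n)) atTop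
        (𝓝 (x + d)) := by
      simpa using (((tendsto_const_nhds (x := (1 : ℝ))).sub hinvφ).smul_const x).add hlim
    refine hclosed.mem_of_tendsto hl (Eventually.of_forall fun n => ?_)
    have h1 : ‖z (φ n)‖⁻¹ ≤ 1 :=
      inv_le_one_of_one_le₀ (by linarith [hzn (φ n), (φ n).cast_nonneg (α := ℝ)])
    exact hconv hx.1 (hz (φ n)).1 (sub_nonneg.2 h1) (inv_nonneg.2 (norm_nonneg _)) (by ring)
  have hdz : d = 0 := by
    simpa using eq_of_mem_nondominated hx hxd (add_le_of_nonpos_right hd0)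
  simp [hdz] at hd

/-- All but one of the sets of the cover are only needed to cover a single compact section. -/
theorem IsConeCompact.isConeSemicompact {p : ℕ} {Y : Set (Fin p → ℝ)} (h : IsConeCompact Y) :
    IsConeSemicompact Y := by
  intro S hS hcov
  simp only [singleton_sub_orderingCone] at hcov ⊢
  rcases S.eq_empty_or_nonempty with rfl | ⟨s, hs⟩
  · exact ⟨∅, le_rfl, Set.finite_empty, hcov⟩
  have hK := h s (hS hs)
  rw [singleton_sub_orderingCone] at hK
  obtain ⟨T, hTS, hTfin, hT⟩ := hK.elim_finite_subcover_image (b := S)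
    (c := fun z => (Set.Iic z)ᶜ) (fun z _ => isClosed_Iic.isOpen_compl)
    (Set.inter_subset_right.trans hcov)
  refine ⟨insert s T, Set.insert_subset hs hTS, hTfin.insert s, fun y hy => ?_⟩
  rw [Set.biUnion_insert]
  by_cases hys : y ≤ s
  · exact Or.inr (hT ⟨hys, hy⟩)
  · exact Or.inl hys

/-! ### Minimisers of exponential sums -/

/-- The scalarising function `y ↦ ∑ j, exp (k * (y j - q j))` with sharpness `k` and reference
point `q`; for large `k` its size is governed by the largest component of `y - q`. -/
noncomputable def expSum {p : ℕ} (k : ℝ) (q y : Fin p → ℝ) : ℝ :=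
  ∑ j, Real.exp (k * (y j - q j))

theorem continuous_expSum {p : ℕ} :
    Continuous fun a : (ℝ × (Fin p → ℝ)) × (Fin p → ℝ) => expSum a.1.1 a.1.2 a.2 := by
  unfold expSum
  fun_prop

theorem strictMono_expSum {p : ℕ} {k : ℝ} (hk : 0 < k) (q : Fin p → ℝ) :
    StrictMono (expSum k q) := by
  intro y z hyz
  obtain ⟨hle, j, hj⟩ := Pi.lt_def.1 hyz
  refine Finset.sum_lt_sum (fun i _ => ?_) ⟨j, Finset.mem_univ j, ?_⟩
  · have := hle i
    gcongr
  · gcongr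

theorem strictConvexOn_expSum {p : ℕ} {k : ℝ} (hk : 0 < k) (q : Fin p → ℝ)
    {C : Set (Fin p → ℝ)} (hC : Convex ℝ C) : StrictConvexOn ℝ C (expSum k q) := by
  refine ⟨hC, fun y _ z _ hyz a b ha hb hab => ?_⟩
  obtain ⟨j, hj⟩ := Function.ne_iff.1 hyz
  have harg : ∀ i, k * ((a • y + b • z) i - q i) =
      a • (k * (y i - q i)) + b • (k * (z i - q i)) := by
    intro i
    simp only [Pi.add_apply, Pi.smul_apply, smul_eq_mul]
    linear_combination (-(k * q i)) * (hab.symm)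
  simp only [expSum, Finset.smul_sum, ← Finset.sum_add_distrib, harg]
  refine Finset.sum_lt_sum (fun i _ => ?_) ⟨j, Finset.mem_univ j, ?_⟩
  · exact convexOn_exp.2 (Set.mem_univ _) (Set.mem_univ _) ha.le hb.le hab
  · refine strictConvexOn_exp.2 (Set.mem_univ _) (Set.mem_univ _) (fun h => hj ?_) ha hb hab
    exact sub_left_injective (mul_left_cancel₀ hk.ne' h)

theorem mem_nondominated_of_isMinOn_expSum {p : ℕ} {C : Set (Fin p → ℝ)} {k : ℝ} (hk : 0 < k)
    {q y : Fin p → ℝ} (hy : y ∈ C) (hmin : IsMinOn (expSum k q) C y) : y ∈ nondominated C :=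
  ⟨hy, fun ⟨_, hz, hzy, hne⟩ =>
    (strictMono_expSum hk q (lt_of_le_of_ne hzy hne)).not_ge (hmin hz)⟩

theorem exists_isMinOn_expSum {p : ℕ} {C : Set (Fin p → ℝ)} (hC : IsCompact C)
    (hne : C.Nonempty) (k : ℝ) (q : Fin p → ℝ) : ∃ y ∈ C, IsMinOn (expSum k q) C y :=
  hC.exists_isMinOn hne
    (continuous_expSum.comp (Continuous.prodMk_right (k, q))).continuousOn

theorem IsConeCompact.nondominatedExternallyStable {p : ℕ} {Y : Set (Fin p → ℝ)}
    (h : IsConeCompact Y) : NondominatedExternallyStable Y := by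
  intro y hy
  have hK := h y hy
  rw [singleton_sub_orderingCone, Set.inter_comm] at hK
  obtain ⟨m, hm, hmin⟩ := exists_isMinOn_expSum hK ⟨y, hy, Set.self_mem_Iic⟩ 1 0
  have hmN := mem_nondominated_of_isMinOn_expSum one_pos hm hmin
  rw [nondominated_inter_Iic] at hmN
  exact ⟨m, hmN.1, y - m, (show 0 ≤ y - m from sub_nonneg.2 hm.2), add_sub_cancel m y⟩

/-! ### Connectedness -/

/-- Unique minimisers over a compact set depend continuously on a parameter. -/
theorem continuous_of_unique_isMinOn {A E : Type*} [TopologicalSpace A] [TopologicalSpace E]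
    {C : Set E} (hC : IsCompact C) {F : A → E → ℝ}
    (hF : Continuous (Function.uncurry F)) {m : A → E} (hm : ∀ a, m a ∈ C)
    (hmin : ∀ a, IsMinOn (F a) C (m a))
    (huniq : ∀ a, ∀ y ∈ C, IsMinOn (F a) C y → y = m a) : Continuous m := by
  refine continuous_iff_continuousAt.2 fun a => ?_
  refine hC.tendsto_nhds_of_unique_mapClusterPt (Eventually.of_forall hm) fun y hy hcl => ?_
  obtain ⟨U, hU, hUy⟩ := mapClusterPt_iff_ultrafilter.1 hcl
  refine huniq a y hy fun z hz => ?_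
  have hUa : Tendsto id (U : Filter A) (𝓝 a) := hU
  have h1 : Tendsto (fun a' => F a' (m a')) U (𝓝 (F a y)) :=
    (hF.tendsto (a, y)).comp (hUa.prodMk_nhds hUy)
  have h2 : Tendsto (fun a' => F a' z) U (𝓝 (F a z)) :=
    (hF.tendsto (a, z)).comp (hUa.prodMk_nhds tendsto_const_nhds)
  exact le_of_tendsto_of_tendsto' h1 h2 fun a' => hmin a' hz

/-- Comparing the minimiser `m k` with `x` itself bounds each component of `m k - x` by
`log p / k`. -/
theorem tendsto_isMinOn_expSum {p : ℕ} {C : Set (Fin p → ℝ)} (hC : IsCompact C)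
    {x : Fin p → ℝ} (hx : x ∈ nondominated C) {m : ℝ → Fin p → ℝ} (hm : ∀ k > 0, m k ∈ C)
    (hmin : ∀ k > 0, IsMinOn (expSum k x) C (m k)) : Tendsto m atTop (𝓝 x) := by
  have hle : ∀ k > 0, ∀ j, m k j ≤ x j + Real.log p / k := by
    intro k hk j
    have h1 : Real.exp (k * (m k j - x j)) ≤ p :=
      calc Real.exp (k * (m k j - x j)) ≤ expSum k x (m k) :=
            Finset.single_le_sum (f := fun i => Real.exp (k * (m k i - x i)))
              (fun i _ => (Real.exp_pos _).le) (Finset.mem_univ j)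
        _ ≤ expSum k x x := hmin k hk hx.1
        _ = p := by simp [expSum]
    have h2 : k * (m k j - x j) ≤ Real.log p :=
      (Real.le_log_iff_exp_le ((Real.exp_pos _).trans_le h1)).2 h1
    have h3 : m k j - x j ≤ Real.log p / k := (le_div_iff₀' hk).2 h2
    linarith
  refine hC.tendsto_nhds_of_unique_mapClusterPt
    ((eventually_gt_atTop 0).mono fun k hk => hm k hk) fun y hy hcl => ?_
  obtain ⟨U, hU, hUy⟩ := mapClusterPt_iff_ultrafilter.1 hcl
  refine eq_of_mem_nondominated hx hy fun j => ?_
  have hlim : Tendsto (fun k : ℝ => x j + Real.log p / k) atTop (𝓝 (x j)) := by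
    simpa using (tendsto_const_nhds (x := x j)).add (tendsto_id.const_div_atTop (Real.log p))
  exact le_of_tendsto_of_tendsto (tendsto_pi_nhds.1 hUy j) (hlim.mono_left hU)
    (hU ((eventually_gt_atTop 0).mono fun k hk => hle k hk j))

theorem isPreconnected_nondominated_of_isCompact {p : ℕ} {C : Set (Fin p → ℝ)}
    (hC : IsCompact C) (hconv : Convex ℝ C) : IsPreconnected (nondominated C) := by
  rcases C.eq_empty_or_nonempty with rfl | hne
  · have : nondominated (∅ : Set (Fin p → ℝ)) = ∅ :=
      Set.eq_empty_of_forall_notMem fun x hx => hx.1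
    rw [this]
    exact isPreconnected_empty
  choose m hm hmin using exists_isMinOn_expSum hC hne
  let f : Set.Ioi (0 : ℝ) × (Fin p → ℝ) → Fin p → ℝ := fun a => m a.1 a.2
  have hf : Continuous f := by
    refine continuous_of_unique_isMinOn hC
      (F := fun a : Set.Ioi (0 : ℝ) × (Fin p → ℝ) => expSum a.1 a.2) ?_
      (fun a => hm a.1 a.2) (fun a => hmin a.1 a.2) (fun a y hy hy' => ?_)
    · exact continuous_expSum.comp
        (((continuous_subtype_val.comp (continuous_fst.comp continuous_fst)).prodMk
          (continuous_snd.comp continuous_fst)).prodMk continuous_snd)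
    · exact (strictConvexOn_expSum a.1.2 a.2 hconv).eq_of_isMinOn hy' (hmin a.1 a.2) hy
        (hm a.1 a.2)
  have : PreconnectedSpace (Set.Ioi (0 : ℝ)) := Subtype.preconnectedSpace isPreconnected_Ioi
  refine (isPreconnected_range hf).subset_closure ?_ fun x hx => ?_
  · rintro _ ⟨a, rfl⟩
    exact mem_nondominated_of_isMinOn_expSum a.1.2 (hm _ _) (hmin _ _)
  · exact mem_closure_of_tendsto
      (tendsto_isMinOn_expSum hC hx (fun k _ => hm k x) (fun k _ => hmin k x))
      ((eventually_gt_atTop 0).mono fun k hk => ⟨(⟨k, hk⟩, x), rfl⟩)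

theorem isPreconnected_nondominated {p : ℕ} {Y : Set (Fin p → ℝ)} (hclosed : IsClosed Y)
    (hconv : Convex ℝ Y) : IsPreconnected (nondominated Y) := by
  refine isPreconnected_of_forall_pair fun x hx y hy => ?_
  have h := isPreconnected_nondominated_of_isCompact
    (isCompact_inter_Iic hclosed hconv hx (x ⊔ y)) (hconv.inter (convex_Iic (x ⊔ y)))
  rw [nondominated_inter_Iic] at h
  exact ⟨_, Set.inter_subset_left, ⟨hx, Set.mem_Iic.2 le_sup_left⟩, ⟨hy, Set.mem_Iic.2 le_sup_right⟩, h⟩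

theorem mainTheorem2 (p : ℕ) (Y : Set (Fin p → ℝ)) (hclosed : IsClosed Y) (hconv : Convex ℝ Y) :
    ((nondominated Y).Nonempty →
      IsConeCompact Y ∧ IsConeSemicompact Y ∧ NondominatedExternallyStable Y ∧
        IsConnected (nondominated Y)) ∧
    IsPreconnected (nondominated Y) := by
  have hpre := isPreconnected_nondominated hclosed hconv
  refine ⟨fun hne => ?_, hpre⟩
  obtain ⟨x, hx⟩ := hne
  have hcompact : IsConeCompact Y := by
    intro y _
    rw [singleton_sub_orderingCone, Set.inter_comm]
    exact isCompact_inter_Iic hclosed hconv hx y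
  exact ⟨hcompact, hcompact.isConeSemicompact, hcompact.nondominatedExternallyStable,
    ⟨x, hx⟩, hpre⟩
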